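/- A ribbon graph with $e\ge 1$ edges is a triple $\Gamma=(H,\alpha,\sigma)$, where $H=\{1,\dots,2e\}$, $\alpha$ is a fixed-point-free involution of $H$, and $\sigma$ is a permutation of $H$ such that the group $\langle\alpha,\sigma\rangle$ acts transitively on $H$. Its vertices are the cycles of $\sigma$ (fixed points included), the degree of a vertex is the length of the cycle, and its faces are the cycles of $\sigma^{-1}\circ\alpha$. If it has $n$ vertices and $f$ faces, its genus $g$ is defined by $n-e+f=2-2g$. A marked ribbon graph is a ribbon graph whose vertices are labelled by $1,\dots,n$. A marked isomorphism is a bijection of the half-edges that intertwines the permutations $\alpha$ and $\sigma$ of the two graphs and preserves the vertex labels; $\mathrm{Aut}_v(\Gamma)$ is the group of marked automorphisms of $\Gamma$. Let $G_{g,n}(\mu_1,\dots,\mu_n)$ be the set of marked-isomorphism classes of marked ribbon graphs of genus $g$ with $n$ vertices, the vertex labelled $i$ having degree $\mu_i$, and put $$C_{g,n}(\mu_1,\dots,\mu_n)=\mu_1\cdots\mu_n\sum_{\Gamma\in G_{g,n}(\mu_1,\dots,\mu_n)}\frac{1}{|\mathrm{Aut}_v(\Gamma)|},$$ with the convention $C_{0,1}(0)=1$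 (the graph consisting of a single point). Then, for every integer $k\ge 0$ and every complex number $c$ with $c^2=2$, $$C_{1,1}(2k+4)=\frac{2^{k+1}\,(2k+3)!!}{3c^2\,k!};$$ equivalently, $C_{1,1}(2k+4)=\dfrac{2^{k}\,(2k+3)!!}{3\,k!}$. Moreover, $C_{1,1}(m)=0$ for every integer $m\ge 0$ that is not of the form $2k+4$ with $k\ge 0$ an integer. -/

import Mathlib

open scoped Nat

/-- A (connected) ribbon graph with `e ≥ 1` edges: half-edges `Fin (2 * e)`, a fixed point free
involution `α` pairing half-edges into edges, a permutation `σ` whose cycles (fixed points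
included) are the vertices, and `⟨α, σ⟩` transitive on half-edges. -/
structure RibbonGraph (e : ℕ) where
  edges_pos : 0 < e
  α : Equiv.Perm (Fin (2 * e))
  σ : Equiv.Perm (Fin (2 * e))
  α_involutive : ∀ h, α (α h) = h
  α_fixedPointFree : ∀ h, α h ≠ h
  connected : MulAction.IsPretransitive
    (Subgroup.closure ({α, σ} : Set (Equiv.Perm (Fin (2 * e))))) (Fin (2 * e))

/-- The number of faces, i.e. of cycles (fixed points included) of `σ⁻¹ ∘ α`. -/
noncomputable def RibbonGraph.numFaces {e : ℕ} (Γ : RibbonGraph e) : ℕ :=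
  Nat.card (Quotient (Equiv.Perm.SameCycle.setoid (Γ.σ⁻¹ * Γ.α)))

/-- A marked ribbon graph with `n` vertices: a ribbon graph together with a labelling of its
vertices by `Fin n`. The labelling is recorded as the map sending each half-edge to the label of
the vertex it is incident to; the two conditions say that this induces a bijection between the
cycles of `σ` and `Fin n`. -/
structure MarkedRibbonGraph (e n : ℕ) extends RibbonGraph e where
  vertex : Fin (2 * e) → Fin n
  vertex_surjective : Function.Surjective vertex
  vertex_eq_iff : ∀ h h', vertex h = vertex h' ↔ σ.SameCycle h h'

namespace MarkedRibbonGraph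

variable {e n : ℕ}

/-- The genus of the underlying ribbon graph is `g`: `n - e + f = 2 - 2 g`. -/
def HasGenus (Γ : MarkedRibbonGraph e n) (g : ℕ) : Prop :=
  (n : ℤ) - (e : ℤ) + (Γ.numFaces : ℤ) = 2 - 2 * (g : ℤ)

/-- The degree of the vertex labelled `i`: the number of half-edges incident to it. -/
noncomputable def degree (Γ : MarkedRibbonGraph e n) (i : Fin n) : ℕ :=
  Nat.card {h : Fin (2 * e) // Γ.vertex h = i}

/-- `ψ` is a marked isomorphism from `Γ` to `Γ'`: a relabelling of half-edges that intertwines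
the permutations and preserves the vertex labels. -/
def IsMarkedIso (Γ Γ' : MarkedRibbonGraph e n) (ψ : Equiv.Perm (Fin (2 * e))) : Prop :=
  (∀ h, Γ'.α (ψ h) = ψ (Γ.α h)) ∧ (∀ h, Γ'.σ (ψ h) = ψ (Γ.σ h)) ∧
    ∀ h, Γ'.vertex (ψ h) = Γ.vertex h

/-- The set of marked automorphisms of a marked ribbon graph. -/
def MarkedAut (Γ : MarkedRibbonGraph e n) : Type :=
  {ψ : Equiv.Perm (Fin (2 * e)) // IsMarkedIso Γ Γ ψ}

theorem IsMarkedIso.refl (Γ : MarkedRibbonGraph e n) : IsMarkedIso Γ Γ 1 :=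
  ⟨fun _ => rfl, fun _ => rfl, fun _ => rfl⟩

theorem IsMarkedIso.inv {Γ Γ' : MarkedRibbonGraph e n} {ψ : Equiv.Perm (Fin (2 * e))}
    (h : IsMarkedIso Γ Γ' ψ) : IsMarkedIso Γ' Γ ψ⁻¹ := by
  obtain ⟨h1, h2, h3⟩ := h
  refine ⟨fun x => ?_, fun x => ?_, fun x => ?_⟩
  · apply ψ.injective
    rw [← h1]; simp
  · apply ψ.injective
    rw [← h2]; simp
  · rw [← h3]; simp

theorem IsMarkedIso.mul {Γ Γ' Γ'' : MarkedRibbonGraph e n} {ψ χ : Equiv.Perm (Fin (2 * e))}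
    (h : IsMarkedIso Γ Γ' ψ) (h' : IsMarkedIso Γ' Γ'' χ) : IsMarkedIso Γ Γ'' (χ * ψ) := by
  obtain ⟨h1, h2, h3⟩ := h
  obtain ⟨k1, k2, k3⟩ := h'
  refine ⟨fun x => ?_, fun x => ?_, fun x => ?_⟩
  · simp [Equiv.Perm.mul_apply, k1, h1]
  · simp [Equiv.Perm.mul_apply, k2, h2]
  · simp [Equiv.Perm.mul_apply, k3, h3]

theorem card_markedAut_eq {Γ Γ' : MarkedRibbonGraph e n}
    (h : ∃ ψ, IsMarkedIso Γ Γ' ψ) : Nat.card Γ.MarkedAut = Nat.card Γ'.MarkedAut := by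
  obtain ⟨ψ, hψ⟩ := h
  refine Nat.card_congr
    { toFun := fun a => ⟨ψ * (a.1 * ψ⁻¹), (hψ.inv.mul a.2).mul hψ⟩
      invFun := fun b => ⟨ψ⁻¹ * (b.1 * ψ), (hψ.mul b.2).mul hψ.inv⟩
      left_inv := fun a => Subtype.ext (by simp [mul_assoc])
      right_inv := fun b => Subtype.ext (by simp [mul_assoc]) }

end MarkedRibbonGraph

/-- Marked ribbon graphs of genus `g` with `n` vertices whose vertex labelled `i` has degree
`μ i`. The degrees of a graph sum to twice its number of edges, so the latter is `(∑ i, μ i) / 2`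
(and there is no such graph when `∑ i, μ i` is odd). -/
def MarkedGraphOfType (g n : ℕ) (μ : Fin n → ℕ) : Type :=
  {Γ : MarkedRibbonGraph ((∑ i, μ i) / 2) n // Γ.HasGenus g ∧ ∀ i, Γ.degree i = μ i}

/-- Two marked graphs are identified when there is a marked isomorphism between them. -/
instance MarkedGraphOfType.setoid (g n : ℕ) (μ : Fin n → ℕ) :
    Setoid (MarkedGraphOfType g n μ) where
  r Γ Γ' := ∃ ψ, MarkedRibbonGraph.IsMarkedIso Γ.1 Γ'.1 ψ
  iseqv :=
    { refl := fun Γ => ⟨1, MarkedRibbonGraph.IsMarkedIso.refl Γ.1⟩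
      symm := fun ⟨ψ, h⟩ => ⟨ψ⁻¹, h.inv⟩
      trans := fun ⟨ψ, h⟩ ⟨χ, h'⟩ => ⟨χ * ψ, h.mul h'⟩ }

/-- The set `G_{g,n}(μ₁, …, μₙ)` of distinct marked graphs (with at least one edge). -/
def MarkedGraphClasses (g n : ℕ) (μ : Fin n → ℕ) : Type :=
  Quotient (MarkedGraphOfType.setoid g n μ)

instance MarkedRibbonGraph.finite (e n : ℕ) : Finite (MarkedRibbonGraph e n) := by
  refine Finite.of_injective
    (fun Γ : MarkedRibbonGraph e n => (Γ.α, Γ.σ, Γ.vertex)) ?_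
  rintro ⟨⟨_, _, _, _, _, _⟩, _, _, _⟩ ⟨⟨_, _, _, _, _, _⟩, _, _, _⟩ h
  simp only [Prod.mk.injEq] at h
  obtain ⟨rfl, rfl, rfl⟩ := h
  rfl

instance MarkedGraphClasses.finite (g n : ℕ) (μ : Fin n → ℕ) :
    Finite (MarkedGraphClasses g n μ) := by
  have : Finite (MarkedGraphOfType g n μ) := by
    unfold MarkedGraphOfType
    infer_instance
  exact Quotient.finite _

/-- The weight `1 / |Aut_v Γ|` of a marked graph. -/
noncomputable def MarkedGraphClasses.weight {g n : ℕ} {μ : Fin n → ℕ} :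
    MarkedGraphClasses g n μ → ℚ :=
  Quotient.lift (fun Γ : MarkedGraphOfType g n μ => 1 / (Nat.card Γ.1.MarkedAut : ℚ))
    (fun _ _ h => by
      show 1 / (Nat.card _ : ℚ) = 1 / (Nat.card _ : ℚ)
      rw [MarkedRibbonGraph.card_markedAut_eq h])

/-- `D_{g,n}(μ₁, …, μₙ)`: the number of marked graphs in `G_{g,n}(μ₁, …, μₙ)`, each counted with
weight `1 / |Aut_v Γ|` (a finite sum). -/
noncomputable def weightedGraphCount (g n : ℕ) (μ : Fin n → ℕ) : ℚ :=
  ∑ᶠ Γ : MarkedGraphClasses g n μ, Γ.weight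

open Classical in
/-- The generalized Catalan numbers `C_{g,n}(μ₁, …, μₙ) = μ₁ ⋯ μₙ · D_{g,n}(μ₁, …, μₙ)`, with the
convention `C_{0,1}(0) = 1` for the graph consisting of a single point. -/
noncomputable def generalizedCatalan (g n : ℕ) (μ : Fin n → ℕ) : ℚ :=
  if g = 0 ∧ n = 1 ∧ ∀ i, μ i = 0 then 1
  else (∏ i, (μ i : ℚ)) * weightedGraphCount g n μ

/-!
By the orbit-stabilizer theorem, `C_{1,1}(2e)` is the number of fixed point free involutions `α` of
`2e` points for which `ρ α` has `e - 1` cycles, where `ρ` is a fixed long cycle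
(`RibbonCount.generalizedCatalan_one_one_even`). These numbers are found by means of the Gaussian
Hermitian matrix model, treated algebraically. On polynomials in the entries of a generic `q × q`
matrix `M` there is a linear functional, built from the powers of a Laplacian, which satisfies
Gaussian integration by parts (`RibbonCount.gaussian_X_mul`) and hence Wick's formula
(`RibbonCount.gaussian_prod_X`). Writing `tr M^{2e}` as a sum over closed walks, which are
colourings of the corners of a polygon, gives
`𝔼[tr M^{2e}] = ∑_α q ^ (number of cycles of ρ α)` (`RibbonCount.matrixGaussian_traceMonomial`), so
the wanted number is the coefficient of `q^{e-1}`.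

Integration by parts also gives loop equations for the expectations of products of traces
`tr M^{a₁} ⋯ tr M^{aᵣ}`: removing an edge either splits a vertex in two, or merges two vertices
(`RibbonCount.matrixGaussian_traceMonomial_add_two_mul`). By induction on the number `d` of edges,
each expectation is a polynomial in `q` of degree at most `d + r`, and its coefficients in degrees
`d + r` and `d + r - 2` are determined (`RibbonCount.hasExpansion_traceProd`). The former is the
product of the planar numbers `C_{0,1}(aᵢ)`; in the latter one factor is replaced by `C_{1,1}(aᵢ)`,
or two factors by `C_{0,2}(aᵢ, aⱼ)`. No topological discussion of connected components is needed:
it suffices that these expressions satisfy the recursion.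

The numbers `C_{0,1}`, `C_{0,2}` and `C_{1,1}` enter as coefficients of explicit power series
solving the corresponding equations. With `S = √(1 - 4X²)`, the first series is `(1 - S) / (2X²)`,
the diagonal of the second is `X² / S⁴`, and therefore the third is `X⁴ / S⁵`, whose coefficients
are the asserted ones (`RibbonCount.torusCoeff_two_mul_add_four`).
-/

/-! ### Generating functions of the planar and genus one counts -/

namespace RibbonCount

open PowerSeries Finset

/-- The generating function `∑ₙ Catₙ X²ⁿ` of rooted planar maps with one vertex, by degree. -/
noncomputable def discSeries : ℚ⟦X⟧ :=
  PowerSeries.expand 2 two_ne_zero (PowerSeries.map (Nat.castRingHom ℚ) catalanSeries)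

/-- The coefficient of `X ^ a` in `discSeries`: the count `C_{0,1}(a)`. -/
noncomputable def discCoeff (a : ℕ) : ℚ := coeff a discSeries

/-- The series `√(1 - 4X²)`, obtained as `1 - 2X² · discSeries`. -/
noncomputable def rootSeries : ℚ⟦X⟧ := 1 - 2 * X ^ 2 * discSeries

/-- The generating function in `a` of the counts `C_{0,2}(a, b)` for fixed `b`, in the closed form
which solves the loop equation. -/
noncomputable def annulusSeries (b : ℕ) : ℚ⟦X⟧ :=
  rootSeries⁻¹ * (X * PowerSeries.mk fun a => (b : ℚ) * discCoeff (a + b - 1))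

/-- The count `C_{0,2}(a, b)`. -/
noncomputable def annulusCoeff (a b : ℕ) : ℚ := coeff a (annulusSeries b)

/-- The generating function `X⁴ / (1 - 4X²)^{5/2}` of the counts `C_{1,1}(a)`. -/
noncomputable def torusSeries : ℚ⟦X⟧ := X ^ 4 * rootSeries⁻¹ ^ 5

/-- The count `C_{1,1}(a)`. -/
noncomputable def torusCoeff (a : ℕ) : ℚ := coeff a torusSeries

theorem discSeries_eq : discSeries = 1 + X ^ 2 * discSeries ^ 2 := by
  have h := congrArg (fun f => PowerSeries.expand 2 two_ne_zero
    (PowerSeries.map (Nat.castRingHom ℚ) f)) catalanSeries_sq_mul_X_add_one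
  simp only [map_add, map_mul, map_pow, map_one, PowerSeries.map_X, PowerSeries.expand_X] at h
  rw [← discSeries] at h
  linear_combination -h

theorem discCoeff_zero : discCoeff 0 = 1 := by
  rw [discCoeff, discSeries_eq]
  simp [pow_two, mul_assoc]

theorem discCoeff_one : discCoeff 1 = 0 := by
  rw [discCoeff, discSeries_eq]
  simp [coeff_one, coeff_X_pow_mul']

theorem discCoeff_add_two (a : ℕ) :
    discCoeff (a + 2) = ∑ p ∈ antidiagonal a, discCoeff p.1 * discCoeff p.2 := by
  rw [discCoeff, discSeries_eq, map_add, mul_comm (X ^ 2), coeff_mul_X_pow, pow_two, coeff_mul]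
  simp [coeff_one, discCoeff]

theorem constantCoeff_rootSeries : constantCoeff rootSeries = 1 := by
  simp [rootSeries]

theorem rootSeries_mul_inv : rootSeries * rootSeries⁻¹ = 1 :=
  PowerSeries.mul_inv_cancel _ (by simp [constantCoeff_rootSeries])

theorem rootSeries_sq : rootSeries ^ 2 = 1 - 4 * X ^ 2 := by
  rw [rootSeries]
  linear_combination (-4 * X ^ 2) * discSeries_eq

theorem annulusSeries_eq (b : ℕ) :
    annulusSeries b = X * (PowerSeries.mk fun a => (b : ℚ) * discCoeff (a + b - 1)) +
      2 * (X ^ 2 * (discSeries * annulusSeries b)) := by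
  have h : rootSeries * annulusSeries b =
      X * (PowerSeries.mk fun a => (b : ℚ) * discCoeff (a + b - 1)) := by
    rw [annulusSeries, ← mul_assoc, rootSeries_mul_inv, one_mul]
  rw [rootSeries] at h
  linear_combination h

theorem annulusCoeff_zero (b : ℕ) : annulusCoeff 0 b = 0 := by
  rw [annulusCoeff, annulusSeries]; simp

theorem two_eq_C : (2 : ℚ⟦X⟧) = C 2 := (map_ofNat C 2).symm

theorem annulusCoeff_one (b : ℕ) : annulusCoeff 1 b = b * discCoeff (b - 1) := by
  rw [annulusCoeff, annulusSeries_eq, two_eq_C, map_add, coeff_C_mul, coeff_X_pow_mul',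
    show (1 : ℕ) = 0 + 1 from rfl, coeff_succ_X_mul]
  simp

/-- The loop equation of the annulus: the edge at a half-edge of the first vertex either ends at the
second vertex, or cuts off a planar piece carrying only one vertex. -/
theorem annulusCoeff_add_two (a b : ℕ) : annulusCoeff (a + 2) b = b * discCoeff (a + b) +
    2 * ∑ p ∈ antidiagonal a, discCoeff p.1 * annulusCoeff p.2 b := by
  rw [annulusCoeff, annulusSeries_eq, two_eq_C, map_add, coeff_C_mul, mul_comm (X ^ 2),
    coeff_mul_X_pow, coeff_succ_X_mul, coeff_mk, coeff_mul,
    show a + 1 + b - 1 = a + b by omega]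
  rfl

/-- The diagonal series `∑_b F_b X^b` of a family of power series. -/
noncomputable def diagonalSeries (F : ℕ → ℚ⟦X⟧) : ℚ⟦X⟧ :=
  PowerSeries.mk fun N => ∑ p ∈ antidiagonal N, coeff p.1 (F p.2)

/-- Multiplication by a series which does not depend on `b` commutes with taking the diagonal. -/
theorem diagonalSeries_mul (f : ℚ⟦X⟧) (F : ℕ → ℚ⟦X⟧) :
    diagonalSeries (fun b => f * F b) = f * diagonalSeries F := by
  ext N
  simp only [diagonalSeries, coeff_mk, coeff_mul, Finset.mul_sum]
  rw [Finset.sum_sigma', Finset.sum_sigma']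
  refine Finset.sum_nbij' (fun x => ⟨(x.2.1, x.2.2 + x.1.2), (x.2.2, x.1.2)⟩)
    (fun x => ⟨(x.1.1 + x.2.1, x.2.2), (x.1.1, x.2.1)⟩) ?_ ?_ ?_ ?_ ?_
  all_goals
    rintro ⟨⟨a, b⟩, ⟨i, j⟩⟩ h
    simp only [Finset.mem_sigma, HasAntidiagonal.mem_antidiagonal, and_true] at h ⊢
  · omega
  · omega
  · obtain ⟨-, rfl⟩ := h; rfl
  · obtain ⟨-, rfl⟩ := h; rfl

theorem derivative_rootSeries : rootSeries * d⁄dX ℚ rootSeries = -4 * X := by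
  have h := congrArg (d⁄dX ℚ) rootSeries_sq
  have h4 : d⁄dX ℚ (4 : ℚ⟦X⟧) = 0 := by
    rw [show (4 : ℚ⟦X⟧) = C 4 from (map_ofNat C 4).symm, derivative_C]
  simp only [derivative_pow, map_sub, Derivation.leibniz, derivative_X, h4, derivative_one] at h
  simp only [smul_eq_mul] at h
  norm_num at h
  have h2 : C (2 : ℚ) * (rootSeries * d⁄dX ℚ rootSeries - -4 * X) = 0 := by
    rw [← two_eq_C]; linear_combination h
  have h3 := (mul_eq_zero.1 h2).resolve_left (by simp)
  linear_combination h3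

theorem derivative_derivative_rootSeries :
    rootSeries ^ 3 * d⁄dX ℚ (d⁄dX ℚ rootSeries) = -4 := by
  have h := congrArg (d⁄dX ℚ) derivative_rootSeries
  have h4 : d⁄dX ℚ (-4 : ℚ⟦X⟧) = 0 := by
    rw [show (-4 : ℚ⟦X⟧) = C (-4) by rw [map_neg, map_ofNat], derivative_C]
  simp only [Derivation.leibniz, derivative_X, h4] at h
  simp only [smul_eq_mul] at h
  have h1 := derivative_rootSeries
  have h2 := rootSeries_sq
  set S := rootSeries
  set S' := d⁄dX ℚ S
  set S'' := d⁄dX ℚ S'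
  linear_combination S ^ 2 * h - (S * S' - 4 * X) * h1 - 4 * h2

/-- On the diagonal the merging term of the annulus equation depends on `b` only through the factor
`b`. Summing over `b` gives binomial coefficients, so that the diagonal series is, up to a factor,
the second derivative of `X² · discSeries = (1 - √(1 - 4X²)) / 2`. -/
theorem diagonalSeries_merge :
    rootSeries ^ 3 * diagonalSeries (fun b => PowerSeries.mk fun a =>
      (b : ℚ) * discCoeff (a + b - 1)) = X := by
  set Z := diagonalSeries (fun b => PowerSeries.mk fun a => (b : ℚ) * discCoeff (a + b - 1))
  have hZ : C (-4 : ℚ) * Z = X * d⁄dX ℚ (d⁄dX ℚ rootSeries) := by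
    ext N
    rw [coeff_C_mul]
    rcases N with _ | N
    · simp [Z, diagonalSeries]
    have hsum : ∑ p ∈ antidiagonal (N + 1), (p.2 : ℚ) = (N + 1) * (N + 2) / 2 := by
      rw [Finset.Nat.sum_antidiagonal_eq_sum_range_succ_mk]
      have := Finset.sum_range_reflect (fun i => (i : ℚ)) (N + 1 + 1)
      simp only [Nat.add_sub_cancel] at this
      rw [this]
      clear this
      induction N with
      | zero => simp [Finset.sum_range_succ]
      | succ n ih => rw [Finset.sum_range_succ, ih]; push_cast; ring
    have h1 : coeff (N + 1) Z = ((N : ℚ) + 1) * (N + 2) / 2 * discCoeff N := by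
      rw [← hsum, Finset.sum_mul]
      simp only [Z, diagonalSeries, coeff_mk]
      refine Finset.sum_congr rfl fun p hp => ?_
      rw [HasAntidiagonal.mem_antidiagonal.1 hp, Nat.add_sub_cancel]
    rw [coeff_succ_X_mul, coeff_derivative, coeff_derivative, h1, rootSeries, map_sub,
      two_eq_C, mul_assoc (C 2), coeff_C_mul, mul_comm (X ^ 2), show N + 1 + 1 = N + 2 from rfl,
      coeff_mul_X_pow, coeff_one, ← discCoeff]
    simp
    ring
  have h3 := derivative_derivative_rootSeries
  have : C (-4 : ℚ) * (rootSeries ^ 3 * Z - X) = 0 := by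
    rw [mul_sub, mul_left_comm, hZ]
    rw [show C (-4 : ℚ) = (-4 : ℚ⟦X⟧) by rw [map_neg, map_ofNat]]
    linear_combination X * h3
  have := (mul_eq_zero.1 this).resolve_left (by simp)
  linear_combination this

theorem diagonalSeries_annulusSeries :
    diagonalSeries annulusSeries = X ^ 2 * rootSeries⁻¹ ^ 4 := by
  have h : diagonalSeries annulusSeries = rootSeries⁻¹ * (X * diagonalSeries (fun b =>
      PowerSeries.mk fun a => (b : ℚ) * discCoeff (a + b - 1))) := by
    rw [← diagonalSeries_mul, ← diagonalSeries_mul]; rfl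
  rw [h]
  have h1 := diagonalSeries_merge
  have h2 := rootSeries_mul_inv
  set Z := diagonalSeries (fun b => PowerSeries.mk fun a => (b : ℚ) * discCoeff (a + b - 1))
  set S := rootSeries
  set T := rootSeries⁻¹
  have h3 : S ^ 3 * T ^ 3 = 1 := by rw [← mul_pow, h2, one_pow]
  linear_combination (X * T ^ 4) * h1 - X * T * Z * h3

/-- The loop equation relating the torus with one boundary to the annulus. -/
theorem torusSeries_eq : torusSeries =
    X ^ 2 * (C 2 * (discSeries * torusSeries) + diagonalSeries annulusSeries) := by
  rw [diagonalSeries_annulusSeries, ← two_eq_C]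
  have h2 := rootSeries_mul_inv
  have h : rootSeries * torusSeries = X ^ 4 * rootSeries⁻¹ ^ 4 := by
    rw [torusSeries]
    linear_combination X ^ 4 * rootSeries⁻¹ ^ 4 * h2
  rw [rootSeries] at h ⊢
  linear_combination h

theorem torusCoeff_zero : torusCoeff 0 = 0 := by simp [torusCoeff, torusSeries]

theorem torusCoeff_one : torusCoeff 1 = 0 := by
  rw [torusCoeff, torusSeries, coeff_X_pow_mul']; simp

theorem torusCoeff_add_two (a : ℕ) : torusCoeff (a + 2) =
    ∑ p ∈ antidiagonal a, (2 * (discCoeff p.1 * torusCoeff p.2) + annulusCoeff p.1 p.2) := by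
  rw [torusCoeff, torusSeries_eq, mul_comm (X ^ 2), coeff_mul_X_pow, map_add, coeff_C_mul,
    coeff_mul, Finset.sum_add_distrib, Finset.mul_sum, diagonalSeries, coeff_mk]
  rfl

/-- The differential equation `(1 - 4X²) G' = 20 X G` of `G = (1 - 4X²)^{-5/2}`, on coefficients. -/
theorem coeff_rootSeries_inv_pow_five (n : ℕ) : ((n : ℚ) + 2) * coeff (n + 2) (rootSeries⁻¹ ^ 5) =
    4 * (n + 5) * coeff n (rootSeries⁻¹ ^ 5) := by
  have h2 := rootSeries_mul_inv
  have hd := derivative_rootSeries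
  have hsq := rootSeries_sq
  set G := rootSeries⁻¹ ^ 5 with hG
  have hD : d⁄dX ℚ G = C 20 * (X * G) + C 4 * (X ^ 2 * d⁄dX ℚ G) := by
    have hG' : d⁄dX ℚ G = -5 * rootSeries⁻¹ ^ 6 * d⁄dX ℚ rootSeries := by
      rw [hG, derivative_pow, derivative_inv']
      norm_num
      ring
    have h20 : C (20 : ℚ) = (20 : ℚ⟦X⟧) := map_ofNat C 20
    have h4 : C (4 : ℚ) = (4 : ℚ⟦X⟧) := map_ofNat C 4
    have e1 : rootSeries ^ 2 * d⁄dX ℚ G = 20 * (X * G) := by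
      rw [hG', hG]
      set S := rootSeries
      set T := rootSeries⁻¹
      set S' := d⁄dX ℚ S
      linear_combination (-5 * T ^ 5) * hd - 5 * T ^ 5 * S * S' * h2
    rw [hsq] at e1
    rw [h20, h4]
    linear_combination e1
  have h := congrArg (coeff (n + 1)) hD
  rw [map_add, coeff_C_mul, coeff_C_mul, coeff_succ_X_mul, coeff_derivative, pow_two, mul_assoc,
    coeff_succ_X_mul] at h
  rcases n with _ | n
  · simp at h
    norm_num
    linarith
  · rw [coeff_succ_X_mul, coeff_derivative] at h
    push_cast at h ⊢
    linear_combination h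

theorem torusCoeff_two_mul_add_four (k : ℕ) :
    torusCoeff (2 * k + 4) = 2 ^ k * ((2 * k + 3)‼ : ℚ) / (3 * (k ! : ℚ)) := by
  rw [torusCoeff, torusSeries, mul_comm (X ^ 4), coeff_mul_X_pow]
  induction k with
  | zero =>
    rw [coeff_zero_eq_constantCoeff_apply, map_pow, constantCoeff_inv, constantCoeff_rootSeries]
    norm_num [Nat.doubleFactorial]
  | succ k ih =>
    have h := coeff_rootSeries_inv_pow_five (2 * k)
    rw [ih] at h
    rw [show 2 * (k + 1) = 2 * k + 2 by ring, show 2 * k + 2 + 3 = (2 * k + 3) + 2 by ring,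
      Nat.doubleFactorial_add_two, Nat.factorial_succ]
    have hk : (k ! : ℚ) ≠ 0 := by positivity
    have hk1 : (k : ℚ) + 1 ≠ 0 := by positivity
    push_cast at h ⊢
    field_simp at h ⊢
    linear_combination h / 2

theorem coeff_rootSeries_inv_pow_five_odd (k : ℕ) : coeff (2 * k + 1) (rootSeries⁻¹ ^ 5) = 0 := by
  induction k with
  | zero =>
    have h := congrArg (coeff 0) derivative_rootSeries
    have h1 : coeff 1 rootSeries = 0 := by
      rw [rootSeries, mul_assoc, two_eq_C, map_sub, coeff_C_mul, coeff_X_pow_mul', coeff_one]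
      simp
    have h2 : coeff 0 (d⁄dX ℚ (rootSeries⁻¹ ^ 5)) = 0 := by
      have h3 : constantCoeff (d⁄dX ℚ rootSeries) = 0 := by
        rw [← coeff_zero_eq_constantCoeff_apply, coeff_derivative, h1, zero_mul]
      rw [derivative_pow, derivative_inv']
      simp [h3]
    rw [coeff_derivative] at h2
    simpa using h2
  | succ k ih =>
    have h := coeff_rootSeries_inv_pow_five (2 * k + 1)
    rw [ih, mul_zero] at h
    exact (mul_eq_zero.1 h).resolve_left (by positivity)

theorem torusCoeff_eq_zero {m : ℕ} (hm : ¬ ∃ k : ℕ, m = 2 * k + 4) : torusCoeff m = 0 := by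
  rw [torusCoeff, torusSeries, coeff_X_pow_mul']
  split_ifs with h
  · obtain ⟨k, hk | hk⟩ := Nat.even_or_odd' (m - 4)
    · exact absurd ⟨k, by omega⟩ hm
    · rw [hk, coeff_rootSeries_inv_pow_five_odd]
  · rfl

end RibbonCount

/-! ### The Gaussian functional and Wick's formula -/

namespace RibbonCount

open MvPolynomial Finset

variable {V : Type*} [Fintype V]

/-- The Laplacian `∑_v ∂_v ∂_{τ v}` on polynomials in variables indexed by `V`. -/
noncomputable def laplacian (τ : V → V) : MvPolynomial V ℚ →ₗ[ℚ] MvPolynomial V ℚ :=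
  ∑ v, (pderiv v : Derivation ℚ (MvPolynomial V ℚ) (MvPolynomial V ℚ)).toLinearMap ∘ₗ
    (pderiv (τ v) : Derivation ℚ (MvPolynomial V ℚ) (MvPolynomial V ℚ)).toLinearMap

/-- The degree `2d` part of the expectation for the centred Gaussian variables with covariance
`𝔼[X_u X_v] = 1` if `u = τ v` and `0` otherwise: the constant coefficient of `(Δ/2)^d p / d!`. -/
noncomputable def gaussian (τ : V → V) (d : ℕ) : MvPolynomial V ℚ →ₗ[ℚ] ℚ :=
  ((2 : ℚ) ^ d * d !)⁻¹ • (lcoeff ℚ (0 : V →₀ ℕ) ∘ₗ (laplacian τ) ^ d)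

theorem laplacian_apply (τ : V → V) (p : MvPolynomial V ℚ) :
    laplacian τ p = ∑ v, pderiv v (pderiv (τ v) p) := by
  simp [laplacian, LinearMap.sum_apply]

theorem pderiv_comm {V : Type*} (u v : V) (p : MvPolynomial V ℚ) :
    pderiv u (pderiv v p) = pderiv v (pderiv u p) := by
  classical
  have h : ⁅(pderiv u : Derivation ℚ (MvPolynomial V ℚ) (MvPolynomial V ℚ)), pderiv v⁆ = 0 :=
    MvPolynomial.derivation_ext fun w => by
      rw [Derivation.commutator_apply, pderiv_X, pderiv_X]
      simp only [Pi.single_apply]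
      split_ifs <;> simp
  have := congrArg (fun D => D p) h
  simpa [Derivation.commutator_apply, sub_eq_zero] using this

theorem pderiv_laplacian (τ : V → V) (v : V) (p : MvPolynomial V ℚ) :
    pderiv v (laplacian τ p) = laplacian τ (pderiv v p) := by
  rw [laplacian_apply, laplacian_apply, map_sum]
  refine Finset.sum_congr rfl fun u _ => ?_
  rw [pderiv_comm, pderiv_comm v (τ u)]

variable [DecidableEq V]

theorem laplacian_X_mul {τ : V → V} (hτ : Function.Involutive τ) (v : V) (p : MvPolynomial V ℚ) :
    laplacian τ (X v * p) = X v * laplacian τ p + 2 * pderiv (τ v) p := by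
  have h (u : V) : pderiv u (pderiv (τ u) (X v * p)) = X v * pderiv u (pderiv (τ u) p) +
      ((if u = v then pderiv (τ v) p else 0) + if u = τ v then pderiv (τ v) p else 0) := by
    have e : (τ u = v) ↔ (u = τ v) := ⟨fun h => by rw [← h, hτ], fun h => by rw [h, hτ]⟩
    have hX (w : V) : pderiv w (X v : MvPolynomial V ℚ) = if w = v then 1 else 0 := by
      rw [pderiv_X, Pi.single_apply]; simp only [eq_comm]
    have hc (c : Prop) [Decidable c] : pderiv u (if c then 1 else 0 : MvPolynomial V ℚ) = 0 := by
      split_ifs <;> simp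
    simp only [Derivation.leibniz, map_add, hX, hc, smul_eq_mul, e]
    by_cases h1 : u = v <;> by_cases h2 : u = τ v
    · simp only [h1, if_true]
      rw [← h2, h1]; simp only [if_true]; ring
    · simp only [h1, if_true]
      rw [h1] at h2; simp only [h2, if_false]; ring
    · simp only [h2, if_true, hτ v]
      rw [h2] at h1; simp only [h1, if_false]; ring
    · simp only [h1, h2, if_false]; ring
  rw [laplacian_apply, laplacian_apply, Finset.sum_congr rfl fun u _ => h u,
    Finset.sum_add_distrib, Finset.sum_add_distrib, Finset.mul_sum]
  simp
  ring

/-- The commutator of a power of the Laplacian with the multiplication by a variable. -/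
theorem laplacian_pow_X_mul {τ : V → V} (hτ : Function.Involutive τ) (v : V) (d : ℕ)
    (p : MvPolynomial V ℚ) : (laplacian τ ^ (d + 1)) (X v * p) =
      X v * (laplacian τ ^ (d + 1)) p +
        (2 * (d + 1) : ℚ) • (laplacian τ ^ d) (pderiv (τ v) p) := by
  induction d generalizing p with
  | zero =>
    simp only [zero_add, pow_one, pow_zero, laplacian_X_mul hτ]
    simp [MvPolynomial.smul_eq_C_mul, map_ofNat]
  | succ d ih =>
    have h2 : (2 : MvPolynomial V ℚ) * pderiv (τ v) p = (2 : ℚ) • pderiv (τ v) p := by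
      rw [MvPolynomial.smul_eq_C_mul, map_ofNat]
    rw [pow_succ _ (d + 1), Module.End.mul_apply, laplacian_X_mul hτ, map_add, ih, h2, map_smul,
      pderiv_laplacian, ← Module.End.mul_apply, ← pow_succ, ← Module.End.mul_apply, ← pow_succ]
    rw [add_assoc, ← add_smul]
    push_cast
    ring_nf

/-- Gaussian integration by parts. -/
theorem gaussian_X_mul {τ : V → V} (hτ : Function.Involutive τ) (v : V) (d : ℕ)
    (p : MvPolynomial V ℚ) :
    gaussian τ (d + 1) (X v * p) = gaussian τ d (pderiv (τ v) p) := by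
  have h0 (q : MvPolynomial V ℚ) : coeff 0 (X v * q) = 0 := by
    rw [mul_comm, ← constantCoeff_eq, map_mul, constantCoeff_X, mul_zero]
  simp only [gaussian, LinearMap.smul_apply, LinearMap.comp_apply, laplacian_pow_X_mul hτ, map_add,
    lcoeff_apply, h0, map_smul, smul_eq_mul, zero_add]
  rw [Nat.factorial_succ, pow_succ]
  push_cast
  field_simp

theorem gaussian_zero_one (τ : V → V) : gaussian τ 0 1 = 1 := by
  simp [gaussian, coeff_one]

variable {Y : Type*} [Fintype Y] [DecidableEq Y]

/-- The perfect matchings of `s`, as involutions with support `s`, which pair a point carrying the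
variable `u` with a point carrying the variable `τ u`. -/
def wickPairings (τ : V → V) (v : Y → V) (s : Finset Y) : Finset (Equiv.Perm Y) :=
  {α | (∀ x, α (α x) = x) ∧ (∀ x, α x ≠ x ↔ x ∈ s) ∧ ∀ x ∈ s, v (α x) = τ (v x)}

/-- Multiplication by the transposition of `x` and `y` removes the pair `{x, y}` from a matching. -/
theorem card_wickPairings_fiber {V : Type*} [DecidableEq V] {τ : V → V} (hτ : Function.Involutive τ) (v : Y → V)
    (s : Finset Y) {x y : Y} (hx : x ∈ s) (hy : y ∈ s.erase x) :
    #{α ∈ wickPairings τ v s | α x = y} =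
      if v y = τ (v x) then #(wickPairings τ v ((s.erase x).erase y)) else 0 := by
  have hxy : y ≠ x := (Finset.mem_erase.1 hy).1
  have hys : y ∈ s := (Finset.mem_erase.1 hy).2
  split_ifs with h
  · have h' : v x = τ (v y) := by rw [h, hτ]
    refine Finset.card_nbij' (fun α => Equiv.swap x y * α) (fun α => Equiv.swap x y * α)
      ?_ ?_ (fun α _ => by simp [← mul_assoc]) (fun α _ => by simp [← mul_assoc])
    · intro α hα
      simp only [wickPairings, Finset.coe_filter, Finset.mem_filter, Finset.mem_univ, true_and,
        Set.mem_ofPred_eq, Finset.mem_erase, Equiv.Perm.mul_apply] at hα ⊢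
      obtain ⟨⟨h1, h2, h3⟩, h4⟩ := hα
      have h5 : α y = x := by rw [← h4, h1]
      have key : ∀ z, Equiv.swap x y (α z) = if z = x then x else if z = y then y else α z := by
        intro z
        split_ifs with e1 e2
        · rw [e1, h4, Equiv.swap_apply_right]
        · rw [e2, h5, Equiv.swap_apply_left]
        · exact Equiv.swap_apply_of_ne_of_ne (fun e => e2 (α.injective (by rw [e, h5])))
            (fun e => e1 (α.injective (by rw [e, h4])))
      simp only [key]
      grind
    · intro α hα
      simp only [wickPairings, Finset.coe_filter, Finset.mem_filter, Finset.mem_univ, true_and,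
        Set.mem_ofPred_eq, Finset.mem_erase, Equiv.Perm.mul_apply] at hα ⊢
      obtain ⟨h1, h2, h3⟩ := hα
      have h4 : α x = x := by by_contra e; exact ((h2 x).1 e).2.1 rfl
      have h5 : α y = y := by by_contra e; exact ((h2 y).1 e).1 rfl
      have key : ∀ z, Equiv.swap x y (α z) = if z = x then y else if z = y then x else α z := by
        intro z
        split_ifs with e1 e2
        · rw [e1, h4, Equiv.swap_apply_left]
        · rw [e2, h5, Equiv.swap_apply_right]
        · exact Equiv.swap_apply_of_ne_of_ne (fun e => e1 (α.injective (by rw [e, h4])))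
            (fun e => e2 (α.injective (by rw [e, h5])))
      simp only [key]
      grind
  · rw [Finset.card_eq_zero, Finset.filter_eq_empty_iff]
    rintro α hα rfl
    simp only [wickPairings, Finset.mem_filter, Finset.mem_univ, true_and] at hα
    exact h (hα.2.2 x hx)

theorem card_wickPairings {V : Type*} [DecidableEq V] {τ : V → V} (hτ : Function.Involutive τ) (v : Y → V)
    (s : Finset Y) {x : Y} (hx : x ∈ s) :
    #(wickPairings τ v s) = ∑ y ∈ s.erase x,
      if v y = τ (v x) then #(wickPairings τ v ((s.erase x).erase y)) else 0 := by
  rw [Finset.card_eq_sum_card_fiberwise (f := fun α => α x) (t := s.erase x)]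
  · exact Finset.sum_congr rfl fun y hy => card_wickPairings_fiber hτ v s hx hy
  · intro α hα
    simp only [wickPairings, Finset.coe_filter, Finset.mem_univ, true_and, Set.mem_ofPred_eq,
      Finset.coe_erase, Set.mem_sdiff, Set.mem_singleton_iff, Finset.mem_coe] at hα ⊢
    obtain ⟨h1, h2, -⟩ := hα
    have hne := (h2 x).2 hx
    exact ⟨(h2 (α x)).1 (by rw [h1]; exact hne.symm), hne⟩

theorem pderiv_prod_X {V Y : Type*} [DecidableEq V] [DecidableEq Y] (u : V) (v : Y → V)
    (s : Finset Y) :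
    pderiv u (∏ x ∈ s, X (v x) : MvPolynomial V ℚ) =
      ∑ y ∈ s, if v y = u then ∏ x ∈ s.erase y, X (v x) else 0 := by
  induction s using Finset.induction_on with
  | empty => simp
  | insert a s ha ih =>
    rw [Finset.prod_insert ha, Derivation.leibniz, ih, Finset.sum_insert ha,
      Finset.erase_insert ha, pderiv_X, Pi.single_apply, add_comm, smul_eq_mul, smul_eq_mul,
      Finset.mul_sum]
    congr 1
    · split_ifs <;> simp_all
    · refine Finset.sum_congr rfl fun y hy => ?_
      have hay : a ≠ y := fun h => ha (h ▸ hy)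
      rw [Finset.erase_insert_of_ne hay, Finset.prod_insert (by simp [ha])]
      split_ifs <;> simp

/-- Wick's formula: the expectation of a monomial counts the pairings of its factors. -/
theorem gaussian_prod_X {τ : V → V} (hτ : Function.Involutive τ) (v : Y → V) (d : ℕ)
    (s : Finset Y) (hs : #s = 2 * d) :
    gaussian τ d (∏ x ∈ s, X (v x)) = #(wickPairings τ v s) := by
  induction d generalizing s with
  | zero =>
    obtain rfl : s = ∅ := Finset.card_eq_zero.1 hs
    have : wickPairings τ v ∅ = {1} := by
      ext α
      simp only [wickPairings, Finset.mem_filter, Finset.mem_univ, true_and, Finset.mem_singleton]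
      constructor
      · rintro ⟨-, h, -⟩
        exact Equiv.ext fun x => by by_contra e; simpa using (h x).1 e
      · rintro rfl; simp
    rw [this, Finset.prod_empty, gaussian_zero_one]
    simp
  | succ d ih =>
    obtain ⟨x, hx⟩ : s.Nonempty := Finset.card_pos.1 (by omega)
    rw [← Finset.mul_prod_erase s _ hx, gaussian_X_mul hτ, pderiv_prod_X, map_sum,
      card_wickPairings hτ v s hx]
    push_cast
    refine Finset.sum_congr rfl fun y hy => ?_
    split_ifs with h
    · rw [ih]
      rw [Finset.card_erase_of_mem hy, Finset.card_erase_of_mem hx]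
      omega
    · simp

end RibbonCount

/-! ### Loop equations for traces of powers of a Gaussian matrix -/

namespace RibbonCount

open MvPolynomial Finset

variable (ι : Type*) [Fintype ι] [DecidableEq ι]

/-- The generic square matrix, with independent variables as entries. -/
noncomputable def genericMatrix : Matrix ι ι (MvPolynomial (ι × ι) ℚ) := fun i j => X (i, j)

/-- The trace of the `a`-th power of the generic matrix. -/
noncomputable def traceMonomial (a : ℕ) : MvPolynomial (ι × ι) ℚ := (genericMatrix ι ^ a).trace

/-- The product of the traces of the powers of the generic matrix with exponents in `L`. -/
noncomputable def traceProd (L : List ℕ) : MvPolynomial (ι × ι) ℚ :=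
  (L.map (traceMonomial ι)).prod

/-- The derivation `∑ᵢⱼ (Mᵃ)ⱼᵢ ∂ⱼᵢ` of the polynomial ring in the entries of the generic matrix
`M`; it maps `tr Mᵇ` to `b tr Mᵃ⁺ᵇ⁻¹`. -/
noncomputable def mergeDerivation (a : ℕ) :
    Derivation ℚ (MvPolynomial (ι × ι) ℚ) (MvPolynomial (ι × ι) ℚ) :=
  ∑ i, ∑ j, (genericMatrix ι ^ a) j i • pderiv (j, i)

theorem mergeDerivation_apply (a : ℕ) (p : MvPolynomial (ι × ι) ℚ) :
    mergeDerivation ι a p = ∑ i, ∑ j, (genericMatrix ι ^ a) j i * pderiv (j, i) p := by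
  rw [mergeDerivation, ← Derivation.coeFnAddMonoidHom_apply, map_sum, Finset.sum_apply]
  refine Finset.sum_congr rfl fun i _ => ?_
  rw [map_sum, Finset.sum_apply]
  rfl

variable {ι}

theorem pderiv_genericMatrix_pow (i j k l : ι) (a : ℕ) :
    pderiv (j, i) ((genericMatrix ι ^ (a + 1)) k l) =
      ∑ p ∈ antidiagonal a, (genericMatrix ι ^ p.1) k j * (genericMatrix ι ^ p.2) i l := by
  have hM (k l : ι) : pderiv (j, i) (genericMatrix ι k l) =
      (1 : Matrix ι ι (MvPolynomial (ι × ι) ℚ)) k j * (1 : Matrix ι ι _) i l := by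
    rw [genericMatrix, pderiv_X, Pi.single_apply, Matrix.one_apply, Matrix.one_apply]
    by_cases h1 : k = j <;> by_cases h2 : l = i <;> simp [h1, h2, Ne.symm]
  induction a generalizing k l with
  | zero => simp [hM]
  | succ a ih =>
    rw [pow_succ, Matrix.mul_apply, map_sum, Finset.Nat.sum_antidiagonal_succ']
    simp only [Derivation.leibniz, hM, smul_eq_mul, ih, Finset.sum_add_distrib]
    congr 1
    · simp [Matrix.one_apply]
    · simp only [Finset.mul_sum]
      rw [Finset.sum_comm]
      refine Finset.sum_congr rfl fun p _ => ?_
      rw [pow_succ, Matrix.mul_apply, Finset.mul_sum]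
      exact Finset.sum_congr rfl fun m _ => by ring

theorem traceMonomial_zero : traceMonomial ι 0 = Fintype.card ι := by
  simp [traceMonomial]

theorem pderiv_traceMonomial (i j : ι) (b : ℕ) :
    pderiv (j, i) (traceMonomial ι b) = b * (genericMatrix ι ^ (b - 1)) i j := by
  rcases b with _ | b
  · simp [traceMonomial_zero]
  · simp only [traceMonomial, Matrix.trace, Matrix.diag_apply, map_sum, pderiv_genericMatrix_pow]
    rw [Finset.sum_comm]
    have h : ∀ p ∈ antidiagonal b, ∑ k, (genericMatrix ι ^ p.1) k j * (genericMatrix ι ^ p.2) i k =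
        (genericMatrix ι ^ b) i j := by
      intro p hp
      rw [← HasAntidiagonal.mem_antidiagonal.1 hp, add_comm, pow_add, Matrix.mul_apply]
      exact Finset.sum_congr rfl fun _ _ => mul_comm _ _
    rw [Finset.sum_congr rfl h]
    simp

theorem mergeDerivation_traceMonomial (a b : ℕ) :
    mergeDerivation ι a (traceMonomial ι b) = b * traceMonomial ι (a + b - 1) := by
  rcases b with _ | b
  · simp [traceMonomial_zero]
  · rw [mergeDerivation_apply]
    simp only [pderiv_traceMonomial, Nat.add_sub_cancel, ← add_assoc]
    rw [traceMonomial, add_comm a b, pow_add, Matrix.trace, Finset.mul_sum]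
    refine Finset.sum_congr rfl fun i _ => ?_
    rw [Matrix.diag_apply, Matrix.mul_apply, Finset.mul_sum]
    exact Finset.sum_congr rfl fun j _ => by ring

/-- The expectation, for the Gaussian Hermitian matrix model, restricted to degree `2d`. -/
noncomputable abbrev matrixGaussian (d : ℕ) : MvPolynomial (ι × ι) ℚ →ₗ[ℚ] ℚ :=
  gaussian Prod.swap d

theorem matrixGaussian_traceMonomial_succ_mul (d a : ℕ) (G : MvPolynomial (ι × ι) ℚ) :
    matrixGaussian (d + 1) (traceMonomial ι (a + 1) * G) =
      matrixGaussian d ((∑ i, ∑ j, pderiv (j, i) ((genericMatrix ι ^ a) j i)) * G) +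
        matrixGaussian d (mergeDerivation ι a G) := by
  have h : traceMonomial ι (a + 1) * G =
      ∑ i, ∑ j, X (i, j) * ((genericMatrix ι ^ a) j i * G) := by
    rw [traceMonomial, pow_succ', Matrix.trace, Finset.sum_mul]
    refine Finset.sum_congr rfl fun i _ => ?_
    rw [Matrix.diag_apply, Matrix.mul_apply, Finset.sum_mul]
    exact Finset.sum_congr rfl fun j _ => by rw [genericMatrix]; ring
  rw [h, ← map_add, mergeDerivation_apply, Finset.sum_mul, ← Finset.sum_add_distrib, map_sum,
    map_sum]
  refine Finset.sum_congr rfl fun i _ => ?_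
  rw [Finset.sum_mul, ← Finset.sum_add_distrib, map_sum, map_sum]
  refine Finset.sum_congr rfl fun j _ => ?_
  rw [matrixGaussian, gaussian_X_mul Prod.swap_swap, Prod.swap_prod_mk, Derivation.leibniz,
    smul_eq_mul, smul_eq_mul, add_comm, mul_comm G]

theorem matrixGaussian_traceMonomial_one_mul (d : ℕ) (G : MvPolynomial (ι × ι) ℚ) :
    matrixGaussian (d + 1) (traceMonomial ι 1 * G) = matrixGaussian d (mergeDerivation ι 0 G) := by
  have h1 (i j k l : ι) :
      pderiv (k, l) ((1 : Matrix ι ι (MvPolynomial (ι × ι) ℚ)) i j) = 0 := by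
    rw [Matrix.one_apply]; split_ifs <;> simp
  rw [← zero_add 1, matrixGaussian_traceMonomial_succ_mul]
  simp [h1]

/-- The loop equation: removing the edge attached to a half-edge of a vertex of degree `a + 2`
either splits this vertex, or merges it with another one. -/
theorem matrixGaussian_traceMonomial_add_two_mul (d a : ℕ) (G : MvPolynomial (ι × ι) ℚ) :
    matrixGaussian (d + 1) (traceMonomial ι (a + 2) * G) =
      ∑ p ∈ antidiagonal a, matrixGaussian d (traceMonomial ι p.1 * (traceMonomial ι p.2 * G)) +
        matrixGaussian d (mergeDerivation ι (a + 1) G) := by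
  rw [matrixGaussian_traceMonomial_succ_mul]
  congr 1
  rw [← map_sum]
  congr 1
  simp only [pderiv_genericMatrix_pow, ← mul_assoc]
  rw [← Finset.sum_mul]
  congr 1
  simp only [traceMonomial, Matrix.trace, Finset.sum_mul_sum, Matrix.diag_apply]
  rw [Finset.sum_comm]
  simp only [Finset.sum_comm (s := univ) (t := antidiagonal a)]

end RibbonCount

/-! ### Expansion of the expectations in the size of the matrix -/

namespace RibbonCount

open Finset

/-- The leading coefficient of the expectation of a product of traces: every vertex is the only
one of a planar component. -/
noncomputable def leadingCoeff (L : List ℕ) : ℚ := (L.map discCoeff).prod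

/-- The sum over the elements `b` of `L` of the contributions in which `a` and `b` are the two
vertices of a planar component, and the other elements of `L` belong to planar components with a
single vertex. -/
noncomputable def annulusSum (a : ℕ) : List ℕ → ℚ
  | [] => 0
  | b :: L => annulusCoeff a b * leadingCoeff L + discCoeff b * annulusSum a L

/-- The subleading coefficient of the expectation of a product of traces: exactly one component
is not planar with one vertex, and it is planar with two vertices or of genus one with one
vertex. -/
noncomputable def subleadingCoeff : List ℕ → ℚ
  | [] => 0
  | a :: L => torusCoeff a * leadingCoeff L + annulusSum a L + discCoeff a * subleadingCoeff L

/-- The leading coefficient of the expectation of the products obtained by merging `a + 1` with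
an element of `L`. -/
noncomputable def mergeSum (a : ℕ) : List ℕ → ℚ
  | [] => 0
  | b :: L => b * discCoeff (a + b - 1) * leadingCoeff L + discCoeff b * mergeSum a L

theorem leadingCoeff_cons (a : ℕ) (L : List ℕ) :
    leadingCoeff (a :: L) = discCoeff a * leadingCoeff L := by simp [leadingCoeff]

theorem annulusSum_zero (L : List ℕ) : annulusSum 0 L = 0 := by
  induction L with
  | nil => rfl
  | cons b L ih => simp [annulusSum, ih, annulusCoeff_zero]

theorem annulusSum_one (L : List ℕ) : annulusSum 1 L = mergeSum 0 L := by
  induction L with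
  | nil => rfl
  | cons b L ih => simp [annulusSum, mergeSum, ih, annulusCoeff_one]

/-- The loop equation of the annulus, summed over the possible second vertices. -/
theorem annulusSum_add_two (a : ℕ) (L : List ℕ) : annulusSum (a + 2) L =
    mergeSum (a + 1) L + 2 * ∑ p ∈ antidiagonal a, discCoeff p.1 * annulusSum p.2 L := by
  induction L with
  | nil => simp [annulusSum, mergeSum]
  | cons b L ih =>
    simp only [annulusSum, mergeSum, ih, annulusCoeff_add_two, mul_add, Finset.sum_add_distrib,
      show a + 1 + b - 1 = a + b by omega]
    simp only [add_mul, mul_assoc, Finset.sum_mul]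
    have : ∑ p ∈ antidiagonal a, discCoeff p.1 * (discCoeff b * annulusSum p.2 L) =
        discCoeff b * ∑ p ∈ antidiagonal a, discCoeff p.1 * annulusSum p.2 L := by
      rw [Finset.mul_sum]
      exact Finset.sum_congr rfl fun _ _ => by ring
    rw [this]
    ring

theorem leadingCoeff_split (a : ℕ) (L : List ℕ) : leadingCoeff ((a + 2) :: L) =
    ∑ p ∈ antidiagonal a, leadingCoeff (p.1 :: p.2 :: L) := by
  simp only [leadingCoeff_cons, discCoeff_add_two, Finset.sum_mul, mul_assoc]

theorem subleadingCoeff_zero (L : List ℕ) : subleadingCoeff (0 :: L) = subleadingCoeff L := by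
  simp [subleadingCoeff, torusCoeff_zero, annulusSum_zero, discCoeff_zero]

theorem subleadingCoeff_one (L : List ℕ) : subleadingCoeff (1 :: L) = mergeSum 0 L := by
  simp [subleadingCoeff, torusCoeff_one, annulusSum_one, discCoeff_one]

/-- The recursion imposed by the loop equation on the subleading coefficient. It is the equations of
the torus and of the annulus, combined by the Leibniz rule. -/
theorem subleadingCoeff_split (a : ℕ) (L : List ℕ) : subleadingCoeff ((a + 2) :: L) =
    (∑ p ∈ antidiagonal a, subleadingCoeff (p.1 :: p.2 :: L)) + mergeSum (a + 1) L := by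
  simp only [subleadingCoeff, annulusSum, leadingCoeff_cons, torusCoeff_add_two,
    annulusSum_add_two, discCoeff_add_two]
  have hT : ∑ p ∈ antidiagonal a, torusCoeff p.1 * (discCoeff p.2 * leadingCoeff L) =
      ∑ p ∈ antidiagonal a, torusCoeff p.2 * (discCoeff p.1 * leadingCoeff L) :=
    (Finset.Nat.sum_antidiagonal_swap (f := fun p : ℕ × ℕ =>
      torusCoeff p.1 * (discCoeff p.2 * leadingCoeff L))).symm
  have hS : ∑ p ∈ antidiagonal a, discCoeff p.2 * annulusSum p.1 L =
      ∑ p ∈ antidiagonal a, discCoeff p.1 * annulusSum p.2 L :=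
    (Finset.Nat.sum_antidiagonal_swap (f := fun p : ℕ × ℕ =>
      discCoeff p.2 * annulusSum p.1 L)).symm
  simp only [mul_add, Finset.sum_add_distrib, hT, hS, Finset.sum_mul, add_mul, Finset.mul_sum,
    two_mul]
  rw [add_comm (mergeSum (a + 1) L) (_ + _), ← add_assoc _ (_ + _) (mergeSum (a + 1) L),
    add_right_comm _ (mergeSum (a + 1) L)]
  congr 1
  simp only [← Finset.sum_add_distrib]
  exact Finset.sum_congr rfl fun p _ => by ring

/-- The expectations of the polynomials `p q` in the entries of a matrix of size `q` are given by
a polynomial in `q` of degree at most `N`, whose coefficients in degrees `N` and `N - 2` are `T`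
and `U`; the coefficient in degree `N - 2` is read as `0` when `N < 2`. -/
def HasExpansion (d N : ℕ) (p : ∀ q : ℕ, MvPolynomial (Fin q × Fin q) ℚ) (T U : ℚ) : Prop :=
  ∃ P : Polynomial ℚ, (∀ q : ℕ, matrixGaussian d (p q) = P.eval (q : ℚ)) ∧
    (∀ k, N < k → P.coeff k = 0) ∧ P.coeff N = T ∧ (∀ k, k + 2 = N → P.coeff k = U) ∧
      (N < 2 → U = 0)

theorem HasExpansion.zero (d N : ℕ) : HasExpansion d N (fun _ => 0) 0 0 :=
  ⟨0, by simp⟩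

variable {d N : ℕ} {p p' : ∀ q : ℕ, MvPolynomial (Fin q × Fin q) ℚ} {T T' U U' : ℚ}

theorem HasExpansion.add (h : HasExpansion d N p T U) (h' : HasExpansion d N p' T' U') :
    HasExpansion d N (fun q => p q + p' q) (T + T') (U + U') := by
  obtain ⟨P, h1, h2, h3, h4, h5⟩ := h
  obtain ⟨P', h1', h2', h3', h4', h5'⟩ := h'
  refine ⟨P + P', fun q => by simp [h1, h1'], fun k hk => by simp [h2 k hk, h2' k hk],
    by simp [h3, h3'], fun k hk => by simp [h4 k hk, h4' k hk], fun hN => by simp [h5 hN, h5' hN]⟩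

theorem HasExpansion.const_mul (c : ℕ) (h : HasExpansion d N p T U) :
    HasExpansion d N (fun q => (c : MvPolynomial (Fin q × Fin q) ℚ) * p q) (c * T) (c * U) := by
  obtain ⟨P, h1, h2, h3, h4, h5⟩ := h
  refine ⟨Polynomial.C (c : ℚ) * P, fun q => ?_, fun k hk => ?_, ?_, fun k hk => ?_, fun hN => ?_⟩
  · simp only [← nsmul_eq_mul, map_nsmul, h1]; simp
  · rw [Polynomial.coeff_C_mul, h2 k hk, mul_zero]
  · rw [Polynomial.coeff_C_mul, h3]
  · rw [Polynomial.coeff_C_mul, h4 k hk]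
  · rw [h5 hN, mul_zero]

theorem HasExpansion.sum {κ : Type*} (s : Finset κ)
    {p : κ → ∀ q : ℕ, MvPolynomial (Fin q × Fin q) ℚ} {T U : κ → ℚ}
    (h : ∀ x ∈ s, HasExpansion d N (p x) (T x) (U x)) :
    HasExpansion d N (fun q => ∑ x ∈ s, p x q) (∑ x ∈ s, T x) (∑ x ∈ s, U x) := by
  classical
  induction s using Finset.induction_on with
  | empty => simpa using HasExpansion.zero d N
  | insert a s ha ih =>
    simp only [Finset.sum_insert ha]
    exact (h a (Finset.mem_insert_self a s)).add
      (ih fun x hx => h x (Finset.mem_insert_of_mem hx))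

/-- A term which is smaller by two degrees contributes only to the subleading coefficient. -/
theorem HasExpansion.weaken (h : HasExpansion d N p T U) : HasExpansion d (N + 2) p 0 T := by
  obtain ⟨P, h1, h2, h3, -, -⟩ := h
  exact ⟨P, h1, fun k hk => h2 k (by omega), h2 _ (by omega),
    fun k hk => by rw [Nat.add_right_cancel hk, h3], fun hN => by omega⟩

theorem HasExpansion.card_mul (h : HasExpansion d N p T U) :
    HasExpansion d (N + 1) (fun q => (q : MvPolynomial (Fin q × Fin q) ℚ) * p q) T U := by
  obtain ⟨P, h1, h2, h3, h4, h5⟩ := h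
  refine ⟨P * Polynomial.X, fun q => ?_, fun k hk => ?_, ?_, fun k hk => ?_,
    fun hN => h5 (by omega)⟩
  · simp only [← nsmul_eq_mul, map_nsmul, h1]; simp [mul_comm]
  · obtain ⟨k, rfl⟩ : ∃ l, k = l + 1 := ⟨k - 1, by omega⟩
    rw [Polynomial.coeff_mul_X, h2 k (by omega)]
  · rw [Polynomial.coeff_mul_X, h3]
  · rcases k with _ | k
    · rw [Polynomial.coeff_mul_X_zero, h5 (by omega)]
    · rw [Polynomial.coeff_mul_X, h4 k (by omega)]

theorem HasExpansion.congr_gaussian {d' : ℕ} (h : HasExpansion d N p T U)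
    (hp : ∀ q, matrixGaussian d' (p' q) = matrixGaussian d (p q)) : HasExpansion d' N p' T U := by
  obtain ⟨P, h1, h⟩ := h
  exact ⟨P, fun q => by rw [hp, h1], h⟩

theorem traceProd_cons (ι : Type*) [Fintype ι] [DecidableEq ι] (a : ℕ) (L : List ℕ) :
    traceProd ι (a :: L) = traceMonomial ι a * traceProd ι L := by simp [traceProd]

/-- The merging term of the loop equation. The list `K` collects the factors which the Leibniz rule
has already passed. -/
theorem hasExpansion_mergeDerivation
    (ih : ∀ L : List ℕ, L.sum = 2 * d → HasExpansion d (d + L.length)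
      (fun q => traceProd (Fin q) L) (leadingCoeff L) (subleadingCoeff L))
    (a : ℕ) (K L : List ℕ) (hKL : a + K.sum + L.sum = 2 * d + 1) :
    HasExpansion d (d + K.length + L.length + 2)
      (fun q => traceProd (Fin q) K * mergeDerivation (Fin q) a (traceProd (Fin q) L))
      0 (leadingCoeff K * mergeSum a L) := by
  induction L generalizing K with
  | nil => simpa [traceProd, mergeSum] using HasExpansion.zero d _
  | cons b L ihL =>
    have h2 := ihL (K ++ [b]) (by simp at hKL ⊢; omega)
    have h1 : HasExpansion d (d + K.length + L.length + 1 + 2)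
        (fun q => (b : MvPolynomial (Fin q × Fin q) ℚ) *
          traceProd (Fin q) (K ++ (a + b - 1) :: L)) (b * 0)
        (b * leadingCoeff (K ++ (a + b - 1) :: L)) := by
      -- for `b = 0` the exponent `a + b - 1` may be truncated, but the factor `b` vanishes
      rcases b with _ | b
      · simpa using HasExpansion.zero d _
      · have := ih (K ++ (a + (b + 1) - 1) :: L) (by simp at hKL ⊢; omega)
        rw [List.length_append, List.length_cons, ← add_assoc, ← add_assoc] at this
        exact this.weaken.const_mul (b + 1)
    rw [List.length_append, List.length_singleton, show d + (K.length + 1) + L.length + 2 =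
      d + K.length + L.length + 1 + 2 by ring] at h2
    have h3 := h1.add h2
    have e : d + K.length + (b :: L).length + 2 = d + K.length + L.length + 1 + 2 := by
      rw [List.length_cons]; ring
    rw [e]
    convert h3 using 1
    · funext q
      rw [traceProd_cons, Derivation.leibniz, mergeDerivation_traceMonomial]
      simp only [traceProd, List.map_append, List.prod_append, List.map_cons, List.prod_cons,
        List.map_nil, List.prod_nil, smul_eq_mul]
      ring
    · ring
    · simp only [mergeSum, leadingCoeff, List.map_append, List.prod_append, List.map_cons,
        List.prod_cons, List.map_nil, List.prod_nil]
      ring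

/-- The loop equations determine the two leading coefficients of the expectation of a product of
traces, as a polynomial in the size of the matrix. -/
theorem hasExpansion_traceProd (d : ℕ) (L : List ℕ) (hL : L.sum = 2 * d) :
    HasExpansion d (d + L.length) (fun q => traceProd (Fin q) L) (leadingCoeff L)
      (subleadingCoeff L) := by
  have hzero (d : ℕ) (L : List ℕ) (h : HasExpansion d (d + L.length)
      (fun q => traceProd (Fin q) L) (leadingCoeff L) (subleadingCoeff L)) :
      HasExpansion d (d + (0 :: L).length) (fun q => traceProd (Fin q) (0 :: L))
        (leadingCoeff (0 :: L)) (subleadingCoeff (0 :: L)) := by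
    rw [leadingCoeff_cons, discCoeff_zero, one_mul, subleadingCoeff_zero, List.length_cons,
      ← add_assoc]
    simpa only [traceProd_cons, traceMonomial_zero, Fintype.card_fin] using h.card_mul
  induction d generalizing L with
  | zero =>
    induction L with
    | nil => exact ⟨1, fun q => by simp [traceProd, gaussian_zero_one],
        fun k hk => by simp [Polynomial.coeff_one] at hk ⊢; omega,
        by simp [leadingCoeff], fun k hk => by simp at hk, fun _ => rfl⟩
    | cons a L ihL =>
      obtain ⟨rfl, h⟩ : a = 0 ∧ L.sum = 2 * 0 := by simp at hL ⊢; exact hL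
      exact hzero 0 L (ihL h)
  | succ d ih =>
    induction L with
    | nil => simp at hL
    | cons a L ihL =>
      rw [List.sum_cons] at hL
      rcases a with _ | _ | a
      · exact hzero (d + 1) L (ihL (by omega))
      · have h := hasExpansion_mergeDerivation ih 0 [] L (by simp; omega)
        rw [leadingCoeff_cons, zero_add, discCoeff_one, zero_mul, subleadingCoeff_one,
          List.length_cons, show d + 1 + (L.length + 1) = d + [].length + L.length + 2 by
            simp; ring]
        simp only [leadingCoeff, List.map_nil, List.prod_nil, one_mul, traceProd] at h
        exact h.congr_gaussian fun q => by
          rw [traceProd_cons, matrixGaussian_traceMonomial_one_mul]; rfl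
      · have h := hasExpansion_mergeDerivation ih (a + 1) [] L (by simp; omega)
        have h' := HasExpansion.sum (d := d) (N := d + (L.length + 1 + 1)) (antidiagonal a)
          (p := fun p q => traceProd (Fin q) (p.1 :: p.2 :: L))
          (T := fun p => leadingCoeff (p.1 :: p.2 :: L))
          (U := fun p => subleadingCoeff (p.1 :: p.2 :: L)) fun p hp => ih (p.1 :: p.2 :: L) (by
          have := HasAntidiagonal.mem_antidiagonal.1 hp
          simp; omega)
        simp only [List.length_cons, List.length_nil, add_zero] at h h' ⊢
        have h'' := h'.add h
        rw [← leadingCoeff_split, add_zero] at h''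
        simp only [leadingCoeff, List.map_nil, List.prod_nil, one_mul] at h''
        rw [← subleadingCoeff_split] at h''
        rw [show d + 1 + (L.length + 1) = d + (L.length + 1 + 1) by ring]
        exact h''.congr_gaussian fun q => by
          rw [traceProd_cons, matrixGaussian_traceMonomial_add_two_mul, map_add, map_sum]
          simp only [traceProd_cons]
          simp [traceProd]

end RibbonCount

/-! ### Counting matchings by the cycles of their product with a rotation -/

namespace RibbonCount

open MvPolynomial Finset

theorem sum_cons {ι R : Type*} [Fintype ι] [AddCommMonoid R] {m : ℕ}
    (F : (Fin (m + 1) → ι) → R) :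
    ∑ f, F f = ∑ i, ∑ g : Fin m → ι, F (Fin.cons i g) := by
  rw [← Fintype.sum_prod_type']
  exact (Fintype.sum_equiv (Fin.consEquiv fun _ => ι) _ _ fun _ => rfl).symm

/-- The entries of a power of a matrix as sums over walks. -/
theorem matrix_pow_succ_apply {ι R : Type*} [Fintype ι] [DecidableEq ι] [CommRing R]
    (A : Matrix ι ι R) (m : ℕ) (i j : ι) :
    (A ^ (m + 1)) i j = ∑ g : Fin m → ι, ∏ k : Fin (m + 1),
      A ((Fin.cons i g : Fin (m + 1) → ι) k) ((Fin.snoc g j : Fin (m + 1) → ι) k) := by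
  induction m generalizing i with
  | zero => simp [Fin.snoc]
  | succ m ih =>
    rw [pow_succ', Matrix.mul_apply, sum_cons]
    refine Finset.sum_congr rfl fun l _ => ?_
    rw [ih, Finset.mul_sum]
    refine Finset.sum_congr rfl fun g _ => ?_
    rw [Fin.prod_univ_succ (n := m + 1), ← Fin.cons_snoc_eq_snoc_cons]
    simp

/-- The trace of a power of a matrix as a sum over closed walks. -/
theorem trace_pow_succ {ι R : Type*} [Fintype ι] [DecidableEq ι] [CommRing R]
    (A : Matrix ι ι R) (m : ℕ) :
    (A ^ (m + 1)).trace = ∑ f : Fin (m + 1) → ι, ∏ k, A (f k) (f (finRotate (m + 1) k)) := by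
  rw [sum_cons, Matrix.trace]
  refine Finset.sum_congr rfl fun i _ => ?_
  rw [Matrix.diag_apply, matrix_pow_succ_apply]
  refine Finset.sum_congr rfl fun g _ => Finset.prod_congr rfl fun k _ => ?_
  congr 1
  rcases Fin.eq_castSucc_or_eq_last k with ⟨l, rfl⟩ | rfl
  · have hl : finRotate (m + 1) l.castSucc = l.succ := finRotate_of_lt l.2
    rw [Fin.snoc_castSucc, hl]
    exact (Fin.cons_succ (α := fun _ => ι) i g l).symm
  · rw [Fin.snoc_last, finRotate_last, Fin.cons_zero]

/-- The number of cycles of a permutation, fixed points included. -/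
noncomputable def cycleCount {X : Type*} (π : Equiv.Perm X) : ℕ :=
  Nat.card (Quotient (Equiv.Perm.SameCycle.setoid π))

/-- A colouring which is invariant under a permutation is a colouring of the set of its cycles. -/
theorem card_invariant_colorings {X : Type*} [Fintype X] [DecidableEq X] (π : Equiv.Perm X)
    (q : ℕ) : #{f : X → Fin q | ∀ x, f (π x) = f x} = q ^ cycleCount π := by
  have h (f : X → Fin q) (hf : ∀ x, f (π x) = f x) (x y : X) (hxy : π.SameCycle x y) :
      f x = f y := by
    obtain ⟨i, -, rfl⟩ := hxy.exists_pow_eq'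
    clear hxy
    induction i with
    | zero => rfl
    | succ i ih => rw [ih, pow_succ', Equiv.Perm.mul_apply, hf]
  have e : {f : X → Fin q // ∀ x, f (π x) = f x} ≃
      (Quotient (Equiv.Perm.SameCycle.setoid π) → Fin q) :=
    { toFun := fun f => Quotient.lift f.1 fun x y hxy => h f.1 f.2 x y hxy
      invFun := fun g => ⟨fun x => g ⟦x⟧, fun x => congrArg g (Quotient.sound
        (Equiv.Perm.sameCycle_apply_left.2 (Equiv.Perm.SameCycle.refl π x)))⟩
      left_inv := fun f => rfl
      right_inv := fun g => by
        funext c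
        induction c using Quotient.inductionOn
        rfl }
  rw [← Fintype.card_subtype, ← Nat.card_eq_fintype_card, Nat.card_congr e, Nat.card_fun,
    Nat.card_fin, cycleCount]

/-- The perfect matchings of a finite type, as fixed point free involutions. -/
def matchings (X : Type*) [Fintype X] [DecidableEq X] : Finset (Equiv.Perm X) :=
  {α | (∀ x, α (α x) = x) ∧ ∀ x, α x ≠ x}

theorem mem_matchings {X : Type*} [Fintype X] [DecidableEq X] {α : Equiv.Perm X} :
    α ∈ matchings X ↔ (∀ x, α (α x) = x) ∧ ∀ x, α x ≠ x := by
  simp [matchings]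

/-- The expectation of the trace of a power counts the gluings of a polygon into a surface, by
number of vertices of the glued polygon. -/
theorem matrixGaussian_traceMonomial (e q : ℕ) (he : 0 < e) :
    matrixGaussian e (traceMonomial (Fin q) (2 * e)) =
      ∑ α ∈ matchings (Fin (2 * e)), (q : ℚ) ^ cycleCount (finRotate (2 * e) * α) := by
  have htr : traceMonomial (Fin q) (2 * e) =
      ∑ f : Fin (2 * e) → Fin q, ∏ k, X (f k, f (finRotate (2 * e) k)) := by
    obtain ⟨m, hm⟩ : ∃ m, 2 * e = m + 1 := ⟨2 * e - 1, by omega⟩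
    rw [hm]
    exact trace_pow_succ _ m
  have hw (f : Fin (2 * e) → Fin q) :
      wickPairings Prod.swap (fun k => (f k, f (finRotate (2 * e) k))) univ =
        {α ∈ matchings (Fin (2 * e)) | ∀ x, f ((finRotate (2 * e) * α) x) = f x} := by
    ext α
    rw [Finset.mem_filter]
    simp only [wickPairings, matchings, Finset.mem_filter, Finset.mem_univ, true_and, iff_true,
      forall_const, Prod.swap_prod_mk, Prod.mk.injEq, Equiv.Perm.mul_apply]
    constructor
    · rintro ⟨h1, h2, h3⟩
      exact ⟨⟨h1, h2⟩, fun x => (h3 x).2⟩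
    · rintro ⟨⟨h1, h2⟩, h3⟩
      exact ⟨h1, h2, fun x => ⟨by rw [← h3 (α x), h1], h3 x⟩⟩
  rw [htr, map_sum]
  rw [Finset.sum_congr rfl fun f _ => gaussian_prod_X Prod.swap_swap
    (fun k => (f k, f (finRotate (2 * e) k))) e univ (by simp)]
  simp only [hw]
  rw [← Nat.cast_sum]
  simp only [Finset.card_filter]
  rw [Finset.sum_comm]
  push_cast
  refine Finset.sum_congr rfl fun α _ => ?_
  rw [← Nat.cast_pow, ← card_invariant_colorings, Finset.card_filter]
  push_cast
  exact Finset.sum_congr rfl fun f _ => by congr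

/-- The number of gluings of a `2e`-gon into a torus. -/
theorem card_matchings_torus (e : ℕ) (he : 0 < e) :
    (#{α ∈ matchings (Fin (2 * e)) | cycleCount (finRotate (2 * e) * α) + 1 = e} : ℚ) =
      torusCoeff (2 * e) := by
  obtain ⟨P, h1, -, -, h4, -⟩ := hasExpansion_traceProd e [2 * e] (by simp)
  have hP : P = ∑ α ∈ matchings (Fin (2 * e)),
      (Polynomial.X : Polynomial ℚ) ^ cycleCount (finRotate (2 * e) * α) := by
    refine Polynomial.eq_of_infinite_eval_eq _ _
      ((Set.infinite_range_of_injective (Nat.cast_injective (R := ℚ))).mono ?_)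
    rintro _ ⟨q, rfl⟩
    have := h1 q
    simp only [traceProd, List.map_cons, List.map_nil, List.prod_cons, List.prod_nil,
      mul_one] at this
    rw [matrixGaussian_traceMonomial e q he] at this
    rw [Set.mem_ofPred_eq, ← this, Polynomial.eval_finsetSum]
    simp
  -- one vertex and `e` edges: the coefficient two degrees below the leading degree `e + 1`
  have h5 := h4 (e - 1) (by simp; omega)
  rw [hP, Polynomial.finsetSum_coeff] at h5
  simp only [Polynomial.coeff_X_pow, subleadingCoeff, leadingCoeff, annulusSum, List.map_nil,
    List.prod_nil, mul_one, mul_zero, add_zero] at h5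
  rw [← h5, Finset.card_filter]
  push_cast
  refine Finset.sum_congr rfl fun α _ => ?_
  congr 1
  rw [eq_iff_iff]
  omega

end RibbonCount

/-! ### Reduction of the weighted count of graphs to matchings -/

namespace RibbonCount

open Finset

theorem markedRibbonGraph_ext {e n : ℕ} {Γ Γ' : MarkedRibbonGraph e n} (h1 : Γ.α = Γ'.α)
    (h2 : Γ.σ = Γ'.σ) (h3 : Γ.vertex = Γ'.vertex) : Γ = Γ' := by
  obtain ⟨⟨_, _, _, _, _, _⟩, _, _, _⟩ := Γ
  obtain ⟨⟨_, _, _, _, _, _⟩, _, _, _⟩ := Γ'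
  simp only at h1 h2 h3
  obtain rfl := h1
  obtain rfl := h2
  obtain rfl := h3
  rfl

theorem cycleCount_conj {X : Type*} (ψ π : Equiv.Perm X) :
    cycleCount (ψ * π * ψ⁻¹) = cycleCount π := by
  refine (Nat.card_congr (Quotient.congr ψ fun x y => ?_)).symm
  change π.SameCycle x y ↔ (ψ * π * ψ⁻¹).SameCycle (ψ x) (ψ y)
  rw [Equiv.Perm.sameCycle_conj]
  simp

/-- The image of a ribbon graph under a relabelling of its half-edges. -/
def relabel {e : ℕ} (Γ : RibbonGraph e) (ψ : Equiv.Perm (Fin (2 * e))) : RibbonGraph e where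
  edges_pos := Γ.edges_pos
  α := ψ * Γ.α * ψ⁻¹
  σ := ψ * Γ.σ * ψ⁻¹
  α_involutive h := by simp [Γ.α_involutive]
  α_fixedPointFree h := by
    intro hh
    refine Γ.α_fixedPointFree (ψ⁻¹ h) (ψ.injective ?_)
    simpa using hh
  connected := by
    refine ⟨fun x y => ?_⟩
    obtain ⟨⟨g, hg⟩, hgx⟩ := Γ.connected.exists_smul_eq (ψ⁻¹ x) (ψ⁻¹ y)
    refine ⟨⟨ψ * g * ψ⁻¹, ?_⟩, ?_⟩
    · have := Subgroup.mem_map_of_mem (MulAut.conj ψ).toMonoidHom hg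
      rw [MonoidHom.map_closure, Set.image_pair] at this
      simpa using this
    · have hgx' : g (ψ⁻¹ x) = ψ⁻¹ y := hgx
      change (ψ * g * ψ⁻¹) x = y
      rw [Equiv.Perm.mul_apply, Equiv.Perm.mul_apply, hgx']
      exact ψ.apply_symm_apply y

/-- Every relabelling of the half-edges of a marked graph is a marked isomorphism onto a graph. -/
theorem exists_isMarkedIso {g n : ℕ} {μ : Fin n → ℕ} (Γ : MarkedGraphOfType g n μ)
    (ψ : Equiv.Perm (Fin (2 * ((∑ i, μ i) / 2)))) :
    ∃ Γ' : MarkedGraphOfType g n μ, MarkedRibbonGraph.IsMarkedIso Γ.1 Γ'.1 ψ := by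
  obtain ⟨Γ, hg, hd⟩ := Γ
  let Γ' : MarkedRibbonGraph ((∑ i, μ i) / 2) n :=
    { relabel Γ.toRibbonGraph ψ with
      vertex := fun h => Γ.vertex (ψ⁻¹ h)
      vertex_surjective := Γ.vertex_surjective.comp ψ⁻¹.surjective
      vertex_eq_iff := fun h h' => by
        rw [Γ.vertex_eq_iff]
        exact (Equiv.Perm.sameCycle_conj (f := Γ.σ) (g := ψ)).symm }
  refine ⟨⟨Γ', ?_, fun i => ?_⟩, fun h => ?_, fun h => ?_, fun h => ?_⟩
  · have : Γ'.numFaces = Γ.numFaces := by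
      have h : Γ'.σ⁻¹ * Γ'.α = ψ * (Γ.σ⁻¹ * Γ.α) * ψ⁻¹ := by
        change (ψ * Γ.σ * ψ⁻¹)⁻¹ * (ψ * Γ.α * ψ⁻¹) = _
        group
      change cycleCount _ = cycleCount _
      rw [h, cycleCount_conj]
    rw [MarkedRibbonGraph.HasGenus, this]
    exact hg
  · rw [← hd i]
    exact Nat.card_congr (Equiv.subtypeEquiv ψ⁻¹ fun h => Iff.rfl)
  · change (ψ * Γ.α * ψ⁻¹) (ψ h) = _
    simp
  · change (ψ * Γ.σ * ψ⁻¹) (ψ h) = _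
    simp
  · change Γ.vertex (ψ⁻¹ (ψ h)) = _
    simp

theorem isMarkedIso_unique {e n : ℕ} {Γ Γ₁ Γ₂ : MarkedRibbonGraph e n}
    {ψ : Equiv.Perm (Fin (2 * e))} (h₁ : Γ.IsMarkedIso Γ₁ ψ) (h₂ : Γ.IsMarkedIso Γ₂ ψ) :
    Γ₁ = Γ₂ := by
  refine markedRibbonGraph_ext (Equiv.ext fun x => ?_) (Equiv.ext fun x => ?_) (funext fun x => ?_)
  all_goals obtain ⟨x, rfl⟩ := ψ.surjective x
  · rw [h₁.1, h₂.1]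
  · rw [h₁.2.1, h₂.2.1]
  · rw [h₁.2.2, h₂.2.2]

instance markedGraphOfType_finite (g n : ℕ) (μ : Fin n → ℕ) :
    Finite (MarkedGraphOfType g n μ) := by
  unfold MarkedGraphOfType; infer_instance

/-- Orbit-stabilizer: the relabellings of the half-edges act on the graphs, with the marked
isomorphism classes as orbits. -/
theorem card_class_mul_card_markedAut {g n : ℕ} {μ : Fin n → ℕ} (Γ : MarkedGraphOfType g n μ) :
    Nat.card {Γ' : MarkedGraphOfType g n μ // ∃ ψ, Γ.1.IsMarkedIso Γ'.1 ψ} *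
      Nat.card Γ.1.MarkedAut = (2 * ((∑ i, μ i) / 2))! := by
  choose act hact using exists_isMarkedIso Γ
  have hact' (Γ' : MarkedGraphOfType g n μ) (ψ) (h : Γ.1.IsMarkedIso Γ'.1 ψ) : act ψ = Γ' :=
    Subtype.ext (isMarkedIso_unique (hact ψ) h)
  choose χ hχ using fun Γ' : {Γ' : MarkedGraphOfType g n μ // ∃ ψ, Γ.1.IsMarkedIso Γ'.1 ψ} => Γ'.2
  rw [← Nat.card_prod]
  have e : Equiv.Perm (Fin (2 * ((∑ i, μ i) / 2))) ≃
      {Γ' : MarkedGraphOfType g n μ // ∃ ψ, Γ.1.IsMarkedIso Γ'.1 ψ} × Γ.1.MarkedAut :=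
    { toFun := fun ψ => (⟨act ψ, ψ, hact ψ⟩,
        ⟨(χ ⟨act ψ, ψ, hact ψ⟩)⁻¹ * ψ, (hact ψ).mul (hχ ⟨act ψ, ψ, hact ψ⟩).inv⟩)
      invFun := fun p => χ p.1 * p.2.1
      left_inv := fun ψ => mul_inv_cancel_left _ _
      right_inv := fun p => by
        have h : (⟨act (χ p.1 * p.2.1), _, hact _⟩ :
            {Γ' : MarkedGraphOfType g n μ // ∃ ψ, Γ.1.IsMarkedIso Γ'.1 ψ}) = p.1 :=
          Subtype.ext (hact' _ _ (p.2.2.mul (hχ p.1)))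
        refine Prod.ext h (Subtype.ext ?_)
        change (χ ⟨act (χ p.1 * p.2.1), _, hact _⟩)⁻¹ * (χ p.1 * p.2.1) = p.2.1
        rw [h, inv_mul_cancel_left] }
  rw [← Nat.card_congr e, Nat.card_eq_fintype_card, Fintype.card_perm, Fintype.card_fin]

theorem weightedGraphCount_mul_factorial (g n : ℕ) (μ : Fin n → ℕ) :
    weightedGraphCount g n μ * ((2 * ((∑ i, μ i) / 2))! : ℚ) =
      Nat.card (MarkedGraphOfType g n μ) := by
  have := Fintype.ofFinite (MarkedGraphClasses g n μ)
  have e : MarkedGraphOfType g n μ ≃ Σ c : MarkedGraphClasses g n μ,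
      {Γ : MarkedGraphOfType g n μ // (Quotient.mk _ Γ : MarkedGraphClasses g n μ) = c} :=
    (Equiv.sigmaFiberEquiv _).symm
  rw [weightedGraphCount, finsum_eq_sum_of_fintype, Nat.card_congr e, Nat.card_sigma,
    Finset.sum_mul, Nat.cast_sum]
  refine Finset.sum_congr rfl fun c _ => ?_
  induction c using Quotient.inductionOn with
  | h Γ =>
    have h1 := card_class_mul_card_markedAut Γ
    have h2 : Nat.card {Γ' : MarkedGraphOfType g n μ //
        (Quotient.mk _ Γ' : MarkedGraphClasses g n μ) = Quotient.mk _ Γ} =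
        Nat.card {Γ' : MarkedGraphOfType g n μ // ∃ ψ, Γ.1.IsMarkedIso Γ'.1 ψ} :=
      Nat.card_congr (Equiv.subtypeEquivRight fun Γ' => by
        rw [eq_comm]; exact Quotient.eq)
    change 1 / (Nat.card Γ.1.MarkedAut : ℚ) * _ = _
    rw [h2, ← h1]
    have h3 : (Nat.card Γ.1.MarkedAut : ℚ) ≠ 0 := by
      intro h
      rw [Nat.cast_eq_zero] at h
      rw [h, mul_zero] at h1
      exact (Nat.factorial_pos _).ne h1
    push_cast
    field_simp

theorem degree_eq_of_one_vertex {e : ℕ} (Γ : MarkedRibbonGraph e 1) : Γ.degree 0 = 2 * e := by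
  rw [MarkedRibbonGraph.degree, Nat.card_congr (Equiv.subtypeUnivEquiv fun h =>
    Subsingleton.elim _ _), Nat.card_fin]

/-- The long cycles are the permutations with a single orbit. -/
theorem cycleType_eq_singleton_iff {n : ℕ} (hn : 2 ≤ n) (σ : Equiv.Perm (Fin n)) :
    σ.cycleType = {n} ↔ ∀ x y, σ.SameCycle x y := by
  constructor
  · intro h x y
    have hc : σ.IsCycle := Equiv.Perm.card_cycleType_eq_one.1 (by simp [h])
    have hs : σ.support = univ := by
      rw [← Finset.card_eq_iff_eq_univ, ← Equiv.Perm.sum_cycleType, h]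
      simp
    have hm (z) : σ z ≠ z := by rw [← Equiv.Perm.mem_support, hs]; exact mem_univ z
    exact hc.sameCycle (hm x) (hm y)
  · intro h
    have hm (z) : σ z ≠ z := by
      intro hz
      have : Nontrivial (Fin n) := Fin.nontrivial_iff_two_le.2 hn
      obtain ⟨w, hw⟩ := exists_ne z
      exact hw ((h z w).eq_of_left hz).symm
    have hc : σ.IsCycle := ⟨⟨0, by omega⟩, hm _, fun y _ => h _ y⟩
    rw [hc.cycleType]
    have : σ.support = univ := by ext z; simp [hm z]
    simp [this]

/-- Graphs of genus one with one vertex, as pairs of a long cycle and a matching. -/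
def graphEquivPairs (μ : Fin 1 → ℕ) (he : 0 < (∑ i, μ i) / 2)
    (hμ : μ 0 = 2 * ((∑ i, μ i) / 2)) :
    MarkedGraphOfType 1 1 μ ≃ Σ σ : {σ : Equiv.Perm (Fin (2 * ((∑ i, μ i) / 2))) //
      σ.cycleType = {2 * ((∑ i, μ i) / 2)}},
      {α // α ∈ matchings (Fin (2 * ((∑ i, μ i) / 2))) ∧
        cycleCount (σ.1⁻¹ * α) + 1 = (∑ i, μ i) / 2} where
  toFun Γ := ⟨⟨Γ.1.σ, (cycleType_eq_singleton_iff (by omega) _).2 fun x y =>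
      (Γ.1.vertex_eq_iff x y).1 (Subsingleton.elim _ _)⟩, Γ.1.α, by
        exact mem_matchings.2 ⟨Γ.1.α_involutive, Γ.1.α_fixedPointFree⟩, by
        have h := Γ.2.1
        rw [MarkedRibbonGraph.HasGenus, show Γ.1.numFaces = cycleCount (Γ.1.σ⁻¹ * Γ.1.α) from rfl]
          at h
        change cycleCount (Γ.1.σ⁻¹ * Γ.1.α) + 1 = _
        omega⟩
  invFun p := ⟨
    { edges_pos := he
      α := p.2.1
      σ := p.1.1
      α_involutive := (mem_matchings.1 p.2.2.1).1
      α_fixedPointFree := (mem_matchings.1 p.2.2.1).2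
      connected := ⟨fun x y => by
        obtain ⟨i, hi⟩ := (cycleType_eq_singleton_iff (by omega) _).1 p.1.2 x y
        exact ⟨⟨p.1.1 ^ i, Subgroup.zpow_mem _ (Subgroup.subset_closure (by simp)) i⟩, hi⟩⟩
      vertex := fun _ => 0
      vertex_surjective := fun i => ⟨⟨0, by omega⟩, Subsingleton.elim _ _⟩
      vertex_eq_iff := fun x y => iff_of_true rfl
        ((cycleType_eq_singleton_iff (by omega) _).1 p.1.2 x y) }, by
    refine ⟨?_, fun i => ?_⟩
    · have h := p.2.2.2
      change ((1 : ℕ) : ℤ) - (((∑ i, μ i) / 2 : ℕ) : ℤ) + (cycleCount (p.1.1⁻¹ * p.2.1) : ℤ) =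
        2 - 2 * ((1 : ℕ) : ℤ)
      omega
    · rw [Subsingleton.elim i 0, degree_eq_of_one_vertex, hμ]⟩
  left_inv Γ := Subtype.ext (markedRibbonGraph_ext rfl rfl (funext fun _ => Subsingleton.elim _ _))
  right_inv p := rfl

/-- Conjugation carries one long cycle to another, together with the matchings. -/
theorem card_matchings_eq_of_cycleType {n : ℕ} (k : ℕ) {σ τ : Equiv.Perm (Fin n)}
    (h : σ.cycleType = τ.cycleType) :
    Nat.card {α // α ∈ matchings (Fin n) ∧ cycleCount (σ⁻¹ * α) + 1 = k} =
      Nat.card {α // α ∈ matchings (Fin n) ∧ cycleCount (τ⁻¹ * α) + 1 = k} := by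
  obtain ⟨ψ, rfl⟩ := isConj_iff.1 (Equiv.Perm.isConj_iff_cycleType_eq.2 h)
  refine Nat.card_congr (Equiv.subtypeEquiv (MulAut.conj ψ).toEquiv fun α => ?_)
  have h1 : (ψ * σ * ψ⁻¹)⁻¹ * (ψ * α * ψ⁻¹) = ψ * (σ⁻¹ * α) * ψ⁻¹ := by group
  have h2 : ψ * α * ψ⁻¹ ∈ matchings (Fin n) ↔ α ∈ matchings (Fin n) := by
    rw [mem_matchings, mem_matchings]
    rw [← ψ.forall_congr_right, ← ψ.forall_congr_right (q := fun x => (ψ * α * ψ⁻¹) x ≠ x)]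
    simp
  change _ ↔ ψ * α * ψ⁻¹ ∈ matchings (Fin n) ∧
    cycleCount ((ψ * σ * ψ⁻¹)⁻¹ * (ψ * α * ψ⁻¹)) + 1 = k
  rw [h1, h2, cycleCount_conj]

theorem card_markedGraphOfType {e : ℕ} (he : 0 < e) {μ : Fin 1 → ℕ} (hμ : μ 0 = 2 * e) :
    (Nat.card (MarkedGraphOfType 1 1 μ) : ℚ) = (2 * e - 1)! * torusCoeff (2 * e) := by
  obtain rfl : (∑ i, μ i) / 2 = e := by rw [Fin.sum_univ_one, hμ]; omega
  rw [← card_matchings_torus _ he, Nat.card_congr (graphEquivPairs μ he hμ), Nat.card_sigma]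
  set e := (∑ i, μ i) / 2
  -- the number of matchings does not depend on the long cycle, and for the inverse of the rotation
  -- it is the number of gluings of a polygon
  have hrot : (finRotate (2 * e))⁻¹.cycleType = {2 * e} := by
    obtain ⟨m, hm⟩ : ∃ m, 2 * e = m + 2 := ⟨2 * e - 2, by omega⟩
    rw [Equiv.Perm.cycleType_inv, hm, cycleType_finRotate]
  have h (σ : {σ : Equiv.Perm (Fin (2 * e)) // σ.cycleType = {2 * e}}) :
      Nat.card {α // α ∈ matchings (Fin (2 * e)) ∧ cycleCount (σ.1⁻¹ * α) + 1 = e} =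
        #{α ∈ matchings (Fin (2 * e)) | cycleCount (finRotate (2 * e) * α) + 1 = e} := by
    rw [card_matchings_eq_of_cycleType e (σ.2.trans hrot.symm), inv_inv,
      Nat.card_eq_fintype_card, Fintype.card_subtype]
    congr 1
    ext α
    simp
  rw [Finset.sum_congr rfl fun σ _ => h σ, Finset.sum_const, Finset.card_univ,
    Fintype.card_subtype, Equiv.Perm.card_of_cycleType_singleton (by omega) (by simp)]
  simp

theorem generalizedCatalan_one_one_even {e : ℕ} (he : 0 < e) :
    generalizedCatalan 1 1 ![2 * e] = torusCoeff (2 * e) := by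
  have h := weightedGraphCount_mul_factorial 1 1 ![2 * e]
  rw [card_markedGraphOfType he rfl] at h
  simp only [Fin.sum_univ_one, Matrix.cons_val_zero, Nat.mul_div_cancel_left e two_pos] at h
  rw [generalizedCatalan, if_neg (by simp), Fin.prod_univ_one, Matrix.cons_val_zero]
  -- there are `(2e - 1)!` long cycles, and the factor `μ₁ = 2e` turns this into `(2e)!`
  rw [← Nat.mul_factorial_pred (show 2 * e ≠ 0 by omega)] at h
  have h1 : ((2 * e - 1)! : ℚ) ≠ 0 := by positivity
  push_cast at h ⊢
  refine mul_left_cancel₀ h1 ?_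
  linear_combination h

theorem generalizedCatalan_one_one_eq_zero {m : ℕ} (hm : ¬ ∃ k : ℕ, m = 2 * k + 4) :
    generalizedCatalan 1 1 ![m] = 0 := by
  obtain ⟨e, rfl | rfl⟩ := Nat.even_or_odd' m
  · rcases Nat.eq_zero_or_pos e with rfl | he
    · rw [generalizedCatalan, if_neg (by simp)]
      simp
    · rw [generalizedCatalan_one_one_even he, torusCoeff_eq_zero hm]
  · have h := weightedGraphCount_mul_factorial 1 1 ![2 * e + 1]
    have : IsEmpty (MarkedGraphOfType 1 1 ![2 * e + 1]) := ⟨fun Γ => by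
      have h1 := Γ.2.2 0
      rw [degree_eq_of_one_vertex] at h1
      simp only [Matrix.cons_val_zero] at h1
      omega⟩
    rw [Nat.card_of_isEmpty, Nat.cast_zero] at h
    rw [generalizedCatalan, if_neg (by simp),
      (mul_eq_zero.1 h).resolve_right (by positivity), mul_zero]

end RibbonCount

theorem mainTheorem3 :
    (∀ c : ℂ, c ^ 2 = 2 → ∀ k : ℕ,
      ((generalizedCatalan 1 1 ![2 * k + 4] : ℚ) : ℂ) =
        2 ^ (k + 1) * ((2 * k + 3)‼ : ℂ) / (3 * c ^ 2 * (k ! : ℂ))) ∧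
    (∀ k : ℕ, generalizedCatalan 1 1 ![2 * k + 4] =
        2 ^ k * ((2 * k + 3)‼ : ℚ) / (3 * (k ! : ℚ))) ∧
    (∀ m : ℕ, (¬ ∃ k : ℕ, m = 2 * k + 4) → generalizedCatalan 1 1 ![m] = 0) := by
  have h (k : ℕ) : generalizedCatalan 1 1 ![2 * k + 4] =
      2 ^ k * ((2 * k + 3)‼ : ℚ) / (3 * (k ! : ℚ)) := by
    rw [show 2 * k + 4 = 2 * (k + 2) by ring,
      RibbonCount.generalizedCatalan_one_one_even (by omega),
      show 2 * (k + 2) = 2 * k + 4 by ring, RibbonCount.torusCoeff_two_mul_add_four]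
  refine ⟨fun c hc k => ?_, h, fun m hm => RibbonCount.generalizedCatalan_one_one_eq_zero hm⟩
  rw [h k, hc]
  have hk : (k ! : ℂ) ≠ 0 := by exact_mod_cast k.factorial_ne_zero
  push_cast
  field_simp
  ring
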